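/- Let $x=x[1]\dots x[n]$ be a string over an alphabet of $\sigma$ letters. For strings $u,v$, call $v$ a rotation of $u$ if $u=pq$ and $v=qp$ for some strings $p,q$. The string $x$ is *cyclic-coverable by* $u$ if for every position $1\le i\le n$ there are $\beta,\gamma$ with $1\le\beta\le i\le\gamma\le n$ such that the factor $x[\beta\,..\,\gamma]$ is a rotation of $u$; and $x$ is *$k'$-cyclic coverable* if it is cyclic-coverable by some string $u$ of length $k'$. There is an algorithm which, given a string $x$ of length $n$, decides for every $k'$ with $1\le k'\le n$ whether $x$ is $k'$-cyclic coverable, in $\mathcal{O}(n^2)$ total time and $\mathcal{O}(n)$ space. More precisely, there are a single program for a random access machine with words of $\mathcal{O}(\log(n+\sigma))$ bits (unit-cost addition, truncated subtraction, comparison, and indirect memory access) and an absolute constant $C$ such that for every $\sigma\geq 0$ and every string $x$ over $\{0,\dots,\sigma-1\}$, started with $n$ in a register and $x$ in its first $n$ memory cells (all other registers and cells being $0$), the program halts after at most $C(n^2+1)$ steps, accesses no memory cells but the first $C(n+1)$, holds in its registers and memory cells only numbers less than $C(n+\sigma+1)$ at all times, and leaves in the $n$ memory cells following the input the answers ($1$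 for yes, $0$ for no) for $k'=1,\dots,n$ in this order. -/

import Mathlib

/-! Cyclic covers of strings. -/

namespace CyclicCover

/-- The factor `x[b .. g]` of `x` (positions are counted from `1`, both ends included). -/
def factor {α : Type*} (x : List α) (b g : ℕ) : List α :=
  (x.drop (b - 1)).take (g + 1 - b)

/-- `x` is cyclic-coverable by `u`: every position `i` of `x` lies in a factor `x[b .. g]` of `x`
that is a rotation of `u`. -/
def CoverableBy {α : Type*} (x u : List α) : Prop :=
  ∀ i, 1 ≤ i → i ≤ x.length →
    ∃ b g, 1 ≤ b ∧ b ≤ i ∧ i ≤ g ∧ g ≤ x.length ∧ (factor x b g).IsRotated u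

/-- `x` is `k`-cyclic coverable: it is cyclic-coverable by some string of length `k`. -/
def Coverable {α : Type*} (x : List α) (k : ℕ) : Prop :=
  ∃ u : List α, u.length = k ∧ CoverableBy x u

end CyclicCover

/-! A random access machine. It has registers (a program is a finite list of instructions and so
mentions only constantly many of them) and a memory of numbered cells. -/

namespace RAM

/-- Instructions; `d`, `a`, `b` are names of registers, `v` is a number, `l` a program line. -/
inductive Instr where
  /-- `R[d] := v` -/
  | const (d v : ℕ)
  /-- `R[d] := R[a]` -/
  | move (d a : ℕ)
  /-- `R[d] := R[a] + R[b]` -/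
  | add (d a b : ℕ)
  /-- `R[d] := max (R[a] - R[b]) 0` -/
  | sub (d a b : ℕ)
  /-- `R[d] := M[R[a]]` -/
  | load (d a : ℕ)
  /-- `M[R[a]] := R[b]` -/
  | store (a b : ℕ)
  /-- `goto l` -/
  | jump (l : ℕ)
  /-- `if R[a] < R[b] then goto l` -/
  | jumpLt (a b l : ℕ)
  /-- `if R[a] = R[b] then goto l` -/
  | jumpEq (a b l : ℕ)

/-- A program; its lines are numbered from `0`. -/
abbrev Program := List Instr

/-- A configuration: the current program line, the registers, and the memory. -/
structure Config where
  pc : ℕ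
  reg : ℕ → ℕ
  mem : ℕ → ℕ

/-- Set register `d` to `v` and go to the next line. -/
def Config.setReg (c : Config) (d v : ℕ) : Config :=
  ⟨c.pc + 1, Function.update c.reg d v, c.mem⟩

/-- The effect of one instruction. -/
def Instr.exec : Instr → Config → Config
  | .const d v, c => c.setReg d v
  | .move d a, c => c.setReg d (c.reg a)
  | .add d a b, c => c.setReg d (c.reg a + c.reg b)
  | .sub d a b, c => c.setReg d (c.reg a - c.reg b)
  | .load d a, c => c.setReg d (c.mem (c.reg a))
  | .store a b, c => ⟨c.pc + 1, c.reg, Function.update c.mem (c.reg a) (c.reg b)⟩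
  | .jump l, c => ⟨l, c.reg, c.mem⟩
  | .jumpLt a b l, c => ⟨if c.reg a < c.reg b then l else c.pc + 1, c.reg, c.mem⟩
  | .jumpEq a b l, c => ⟨if c.reg a = c.reg b then l else c.pc + 1, c.reg, c.mem⟩

/-- One step: execute the instruction on the current line, if there is one. -/
def step (P : Program) (c : Config) : Config :=
  match P[c.pc]? with
  | none => c
  | some i => i.exec c

/-- The machine halts when it leaves the program. -/
def Halted (P : Program) (c : Config) : Prop := P.length ≤ c.pc

/-- The memory address, if any, that an instruction reads or writes in a configuration. -/
def Instr.address : Instr → Config → Option ℕ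
  | .load _ a, c => some (c.reg a)
  | .store a _, c => some (c.reg a)
  | _, _ => none

/-- In configuration `c`, all registers and memory cells hold numbers below `W`, and the
instruction that comes next (if any) accesses the memory only at an address below `S`. -/
def WithinBounds (P : Program) (S W : ℕ) (c : Config) : Prop :=
  (∀ r, c.reg r < W) ∧ (∀ a, c.mem a < W) ∧
    ∀ i, P[c.pc]? = some i → ∀ a, i.address c = some a → a < S

/-- Started in `c`, the machine halts in `c'` after at most `T` steps, it uses no memory but the
first `S` cells, and it holds only numbers below `W` at all times. -/
def RunsWithin (P : Program) (T S W : ℕ) (c c' : Config) : Prop :=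
  ∃ t ≤ T, (step P)^[t] c = c' ∧ Halted P c' ∧ ∀ s ≤ t, WithinBounds P S W ((step P)^[s] c)

/-- The initial configuration on a string `x` of length `n` over the alphabet `{0, …, σ - 1}`:
register `0` holds `n`, the memory cells `0, …, n - 1` hold the letters of `x`, and all other
registers and cells hold `0`. -/
def init {σ : ℕ} (x : List (Fin σ)) : Config where
  pc := 0
  reg := fun r => if r = 0 then x.length else 0
  mem := fun a => (x[a]?).elim 0 Fin.val

end RAM

/-! Position 1 lies only in factors that start there, so a covering string of length `k` can be
replaced by the prefix `u` of length `k` (`coverable_iff`). An occurrence in `x` of a rotation of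
`u` is a suffix of `u` followed by a prefix of `u`; let them meet at `j`. The pieces have lengths at
most `lcsuffix x k j` and `min (Z j) k`, and all lengths within these bounds that add up to `k`
occur. Hence the rotations split at `j`, if any, cover one interval, and the question is whether at
most `n` intervals leave a gap (`covered_iff`).

The table `Z` is independent of `k`, and naive comparison fills it in quadratic time
(`reaches_lcp_table`). For each `k`, a linear pass turns one row of `lcsuffix` into the next and
stores the furthest right end for every left end (`reaches_row`); a second linear pass detects gaps
by a running maximum (`reaches_scan`). Only one row is kept, so the space is linear. The runs are
verified in a program logic, `Reaches`, that carries the time, space and word bounds along. -/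

namespace CyclicCover

/-! ### Combinatorics of rotations of a prefix -/

/-- The length of the longest common suffix of the prefixes of length `k` and `j` of `x`. -/
def lcsuffix (x : ℕ → ℕ) : ℕ → ℕ → ℕ
  | 0, _ => 0
  | _ + 1, 0 => 0
  | k + 1, j + 1 => if x j = x k then lcsuffix x k j + 1 else 0

/-- `z` is the length of the longest common prefix of the word `x[0, n)` and its suffix at `j`. -/
def IsLcp (x : ℕ → ℕ) (n j z : ℕ) : Prop :=
  j + z ≤ n ∧ (∀ t < z, x (j + t) = x t) ∧ (j + z = n ∨ x (j + z) ≠ x z)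

/-- Links the recurrence, which the machine evaluates, to the matching of letters, which the
covering argument needs. -/
theorem le_lcsuffix_iff (x : ℕ → ℕ) (k j s : ℕ) :
    s ≤ lcsuffix x k j ↔ s ≤ k ∧ s ≤ j ∧ ∀ t < s, x (j - 1 - t) = x (k - 1 - t) := by
  induction k generalizing j s with
  | zero =>
    simp only [lcsuffix]
    exact ⟨fun h => ⟨h, by omega, fun t ht => by omega⟩, fun h => h.1⟩
  | succ k ih =>
    cases j with
    | zero =>
      simp only [lcsuffix]
      exact ⟨fun h => ⟨by omega, h, fun t ht => by omega⟩, fun h => h.2.1⟩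
    | succ j =>
      cases s with
      | zero => simp
      | succ s =>
        have shift (m t : ℕ) : m + 1 - 1 - (t + 1) = m - 1 - t := by omega
        simp only [lcsuffix]
        split_ifs with h
        · rw [Nat.add_le_add_iff_right, ih]
          constructor
          · rintro ⟨h1, h2, h3⟩
            refine ⟨by omega, by omega, fun t ht => ?_⟩
            cases t with
            | zero => simpa using h
            | succ t => rw [shift, shift]; exact h3 t (by omega)
          · rintro ⟨h1, h2, h3⟩
            refine ⟨by omega, by omega, fun t ht => ?_⟩
            have := h3 (t + 1) (by omega)
            rwa [shift, shift] at this
        · constructor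
          · omega
          · rintro ⟨-, -, h3⟩
            exact absurd (by simpa using h3 0 (by omega)) h

theorem lcsuffix_le_left (x : ℕ → ℕ) (k j : ℕ) : lcsuffix x k j ≤ k :=
  ((le_lcsuffix_iff x k j _).1 le_rfl).1

theorem lcsuffix_le_right (x : ℕ → ℕ) (k j : ℕ) : lcsuffix x k j ≤ j :=
  ((le_lcsuffix_iff x k j _).1 le_rfl).2.1

theorem lcsuffix_self (x : ℕ → ℕ) (k : ℕ) : lcsuffix x k k = k :=
  le_antisymm (lcsuffix_le_left x k k) ((le_lcsuffix_iff x k k k).2 ⟨le_rfl, le_rfl, by simp⟩)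

theorem IsLcp.le_iff {x : ℕ → ℕ} {n j z : ℕ} (h : IsLcp x n j z) (s : ℕ) :
    s ≤ z ↔ j + s ≤ n ∧ ∀ t < s, x (j + t) = x t := by
  obtain ⟨h1, h2, h3⟩ := h
  constructor
  · intro hs
    exact ⟨by omega, fun t ht => h2 t (by omega)⟩
  · rintro ⟨hs, hm⟩
    by_contra hlt
    rcases h3 with h3 | h3
    · omega
    · exact h3 (hm z (by omega))

/-- The interval of positions, with ends `j - lcsuffix x k j` and `j + min (Z j) k`, that is the
union of the rotations of the prefix of length `k` split at `j`, is not empty. -/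
def IsSplit (x Z : ℕ → ℕ) (n k j : ℕ) : Prop :=
  1 ≤ j ∧ j ≤ n ∧ k ≤ lcsuffix x k j + min (Z j) k

/-- The position `i` lies in a factor that is a rotation of the prefix of length `k`. -/
def Covered (x Z : ℕ → ℕ) (n k i : ℕ) : Prop :=
  ∃ j, IsSplit x Z n k j ∧ j - lcsuffix x k j ≤ i ∧ i < j + min (Z j) k

/-- The factor of length `k` at `b` is a rotation of the prefix of length `k`, split after its
first `s` letters. -/
def IsRotationAt (x : ℕ → ℕ) (k b s : ℕ) : Prop :=
  s ≤ k ∧ (∀ t < s, x (b + t) = x (k - s + t)) ∧ ∀ t < k - s, x (b + s + t) = x t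

/-- For a fixed split point the admissible starts are consecutive, so windows of length `k ≥ 1` at
these starts leave no hole between the extreme ends. -/
theorem covered_iff {x Z : ℕ → ℕ} {n k i : ℕ} (hk : 1 ≤ k) (hkn : k ≤ n)
    (hZ : ∀ j, 1 ≤ j → j ≤ n → IsLcp x n j (Z j)) :
    Covered x Z n k i ↔ ∃ b s, b ≤ i ∧ i < b + k ∧ b + k ≤ n ∧ IsRotationAt x k b s := by
  constructor
  · rintro ⟨j, ⟨hj1, hjn, hs⟩, h1, h2⟩
    have hz := hZ j hj1 hjn
    have hl := lcsuffix_le_left x k j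
    have hr := lcsuffix_le_right x k j
    have hzn := hz.1
    -- the last admissible start if it is at most `i`, and `i` otherwise
    obtain ⟨b, hb1, hb2, hbi, hik⟩ : ∃ b, j - lcsuffix x k j ≤ b ∧ b + k ≤ j + min (Z j) k ∧
        b ≤ i ∧ i < b + k := by
      by_cases hi : i + k ≤ j + min (Z j) k
      · exact ⟨i, h1, hi, le_rfl, by omega⟩
      · exact ⟨j + min (Z j) k - k, by omega, by omega, by omega, by omega⟩
    have hL := (le_lcsuffix_iff x k j (j - b)).1 (by omega)
    have hP := (hz.le_iff (b + k - j)).1 (by omega)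
    refine ⟨b, j - b, hbi, hik, by omega, by omega, fun t ht => ?_, fun t ht => ?_⟩
    -- `le_lcsuffix_iff` counts leftwards from the split point and `IsRotationAt` rightwards from
    -- `b`, hence the reflected index.
    · have := hL.2.2 (j - b - 1 - t) (by omega)
      rwa [show j - 1 - (j - b - 1 - t) = b + t by omega,
        show k - 1 - (j - b - 1 - t) = k - (j - b) + t by omega] at this
    · have := hP.2 t (by omega)
      rwa [show b + (j - b) = j by omega]
  · rintro ⟨b, s, hbi, hik, hbn, hsk, h1, h2⟩
    -- a split point `0` is replaced by `k`
    by_cases hj : b + s = 0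
    · have hz := hZ k hk hkn
      have := lcsuffix_self x k
      refine ⟨k, ⟨hk, hkn, by omega⟩, by omega, by omega⟩
    · have hz := hZ (b + s) (by omega) (by omega)
      have hL : s ≤ lcsuffix x k (b + s) := by
        refine (le_lcsuffix_iff x k (b + s) s).2 ⟨hsk, by omega, fun t ht => ?_⟩
        have := h1 (s - 1 - t) (by omega)
        rwa [show b + (s - 1 - t) = b + s - 1 - t by omega,
          show k - s + (s - 1 - t) = k - 1 - t by omega] at this
      have hP : k - s ≤ Z (b + s) := (hz.le_iff _).2 ⟨by omega, h2⟩
      exact ⟨b + s, ⟨by omega, by omega, by omega⟩, by omega, by omega⟩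

/-- The letters of a string as numbers, continued by `0`. -/
def letter {σ : ℕ} (x : List (Fin σ)) (a : ℕ) : ℕ := (x[a]?).elim 0 Fin.val

theorem letter_eq_iff {σ : ℕ} {x : List (Fin σ)} {a b : ℕ} (ha : a < x.length)
    (hb : b < x.length) : letter x a = letter x b ↔ x[a]? = x[b]? := by
  simp [letter, ha, hb, Fin.ext_iff]

/-- Rotating the prefix by `k - s` moves its last `s` letters to the front; comparing letter by
letter gives `IsRotationAt`. -/
theorem isRotated_take_iff {σ : ℕ} {x : List (Fin σ)} {k b : ℕ} (hbn : b + k ≤ x.length) :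
    ((x.drop b).take k).IsRotated (x.take k) ↔ ∃ s, IsRotationAt (letter x) k b s := by
  have hlen : (x.take k).length = k := by simp; omega
  have key (s : ℕ) (hs : s ≤ k) :
      (x.take k).rotate (k - s) = (x.drop b).take k ↔ IsRotationAt (letter x) k b s := by
    rw [List.rotate_eq_drop_append_take (by omega), IsRotationAt, List.ext_getElem?_iff]
    have hl : ((x.take k).drop (k - s)).length = s := by simp; omega
    have get (t : ℕ) : ((x.take k).drop (k - s) ++ (x.take k).take (k - s))[t]? =
        if t < s then x[k - s + t]? else if t - s < k - s then x[t - s]? else none := by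
      rw [List.getElem?_append, hl]
      split_ifs with h1 h2
      · rw [List.getElem?_drop, List.getElem?_take, if_pos (by omega)]
      · rw [List.getElem?_take, if_pos h2, List.getElem?_take, if_pos (by omega)]
      · rw [List.getElem?_take, if_neg h2]
    have get' (t : ℕ) : ((x.drop b).take k)[t]? = if t < k then x[b + t]? else none := by
      rw [List.getElem?_take, List.getElem?_drop]
    simp only [get, get']
    constructor
    · intro h
      refine ⟨hs, fun t ht => ?_, fun t ht => ?_⟩
      · have := h t
        rw [if_pos ht, if_pos (by omega)] at this
        exact (letter_eq_iff (by omega) (by omega)).2 this.symm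
      · have := h (s + t)
        rw [if_neg (by omega), if_pos (by omega), if_pos (by omega), Nat.add_sub_cancel_left,
          ← add_assoc] at this
        exact (letter_eq_iff (by omega) (by omega)).2 this.symm
    · rintro ⟨-, h1, h2⟩ t
      split_ifs with g1 g2 g3 g4
      · exact ((letter_eq_iff (by omega) (by omega)).1 (h1 t g1)).symm
      · omega
      · have := (letter_eq_iff (by omega) (by omega)).1 (h2 (t - s) g3)
        rw [← this]; congr 1; omega
      · omega
      · omega
      · rfl
  rw [List.isRotated_comm, List.isRotated_iff_mod, hlen]
  constructor
  · rintro ⟨m, hm, h⟩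
    exact ⟨k - m, (key _ (by omega)).1 (by rwa [show k - (k - m) = m by omega])⟩
  · rintro ⟨s, h⟩
    exact ⟨k - s, by omega, (key s h.1).2 h⟩

theorem coverable_iff {σ : ℕ} {x : List (Fin σ)} {k : ℕ} (hk : 1 ≤ k) (hkn : k ≤ x.length) :
    Coverable x k ↔ ∀ i < x.length, ∃ b s, b ≤ i ∧ i < b + k ∧ b + k ≤ x.length ∧
      IsRotationAt (letter x) k b s := by
  have hfac (u : List (Fin σ)) (hu : u.length = k) (b g : ℕ) (hb : 1 ≤ b) (hbg : b ≤ g)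
      (hg : g ≤ x.length) (h : (factor x b g).IsRotated u) : g + 1 - b = k := by
    have := h.perm.length_eq
    simp only [factor, List.length_take, List.length_drop] at this
    omega
  constructor
  · rintro ⟨u, hu, hc⟩
    -- The factor covering position 1 is the prefix itself, so `u` can be exchanged for it.
    have hpre : (x.take k).IsRotated u := by
      obtain ⟨b, g, hb, hb1, h1g, hg, h⟩ := hc 1 le_rfl (by omega)
      have := hfac u hu b g hb (by omega) hg h
      obtain rfl : b = 1 := by omega
      rw [factor, this] at h
      simpa using h
    intro i hi
    obtain ⟨b, g, hb, hbi, hig, hg, h⟩ := hc (i + 1) (by omega) (by omega)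
    have hlen := hfac u hu b g hb (by omega) hg h
    rw [factor, hlen] at h
    obtain ⟨s, hs⟩ := (isRotated_take_iff (by omega)).1 (h.trans hpre.symm)
    -- `factor` counts positions from 1, `IsRotationAt` from 0.
    exact ⟨b - 1, s, by omega, by omega, by omega, hs⟩
  · intro h
    refine ⟨x.take k, by simp; omega, fun i hi hin => ?_⟩
    obtain ⟨b, s, hbi, hik, hbn, hs⟩ := h (i - 1) (by omega)
    refine ⟨b + 1, b + k, by omega, by omega, by omega, by omega, ?_⟩
    rw [factor, show b + k + 1 - (b + 1) = k by omega, Nat.add_sub_cancel]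
    exact (isRotated_take_iff hbn).2 ⟨s, hs⟩

theorem coverable_iff_forall_covered {σ : ℕ} {x : List (Fin σ)} {Z : ℕ → ℕ} {k : ℕ} (hk : 1 ≤ k)
    (hkn : k ≤ x.length)
    (hZ : ∀ j, 1 ≤ j → j ≤ x.length → IsLcp (letter x) x.length j (Z j)) :
    Coverable x k ↔ ∀ i < x.length, Covered (letter x) Z x.length k i := by
  rw [coverable_iff hk hkn]
  exact forall₂_congr fun i _ => (covered_iff hk hkn hZ).symm

end CyclicCover

/-! ### A program logic with time, space and word bounds -/

namespace RAM

/-- All registers and memory cells hold numbers below `W`. -/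
def Config.Small (W : ℕ) (c : Config) : Prop := (∀ r, c.reg r < W) ∧ ∀ a, c.mem a < W

/-- Started in `c`, if its numbers are below `W`, the machine gets within the bounds `S` and `W`
in at most `T` steps to a configuration that satisfies `Q`. -/
def Reaches (P : Program) (S W T : ℕ) (c : Config) (Q : Config → Prop) : Prop :=
  c.Small W → ∃ t ≤ T, Q ((step P)^[t] c) ∧ ((step P)^[t] c).Small W ∧
    ∀ s < t, WithinBounds P S W ((step P)^[s] c)

/-- The registers with the contents `l`, followed by zeros. -/
def regs (l : List ℕ) (r : ℕ) : ℕ := l.getD r 0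

theorem update_regs {l : List ℕ} {d : ℕ} (hd : d < l.length) (v : ℕ) :
    Function.update (regs l) d v = regs (l.set d v) := by
  funext r
  by_cases h : r = d
  · subst h; simp [regs, hd]
  · simp [regs, h, Ne.symm h]

theorem update_lt {f : ℕ → ℕ} {W d v : ℕ} (hf : ∀ r, f r < W) (hv : v < W) (r : ℕ) :
    Function.update f d v r < W := by
  by_cases h : r = d
  · subst h; simpa using hv
  · simpa [h] using hf r

namespace Reaches

variable {P : Program} {S W T : ℕ} {Q : Config → Prop}

theorem of_post {c : Config} (h : Q c) : Reaches P S W T c Q := fun hs =>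
  ⟨0, Nat.zero_le _, h, hs, fun s hs => absurd hs (Nat.not_lt_zero s)⟩

theorem imp {Q' : Config → Prop} {c : Config} (h : Reaches P S W T c Q) (hQ : ∀ c, Q c → Q' c) :
    Reaches P S W T c Q' := fun hs =>
  let ⟨t, ht, h', hb⟩ := h hs
  ⟨t, ht, hQ _ h', hb⟩

theorem mono {T' : ℕ} {c : Config} (h : Reaches P S W T c Q) (hT : T ≤ T') :
    Reaches P S W T' c Q := fun hs =>
  let ⟨t, ht, h'⟩ := h hs
  ⟨t, ht.trans hT, h'⟩

/-- Prepends one instruction to a run. Applied backwards, the rules below execute the program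
symbolically, with `Q` as the final goal. -/
theorem step {c : Config} {i : Instr} (hi : P[c.pc]? = some i)
    (hsmall : c.Small W → (i.exec c).Small W) (haddr : ∀ a, i.address c = some a → a < S)
    (h : Reaches P S W T (i.exec c) Q) : Reaches P S W (T + 1) c Q := by
  intro hc
  obtain ⟨t, ht, h1, h2, h3⟩ := h (hsmall hc)
  have hstep : RAM.step P c = i.exec c := by simp [RAM.step, hi]
  refine ⟨t + 1, by omega, ?_, ?_, fun s hs => ?_⟩
  · rwa [Function.iterate_succ_apply, hstep]
  · rwa [Function.iterate_succ_apply, hstep]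
  · cases s with
    | zero =>
      refine ⟨hc.1, hc.2, fun i' hi' a ha => haddr a ?_⟩
      obtain rfl : i = i' := Option.some.inj (hi.symm.trans hi')
      exact ha
    | succ s =>
      rw [Function.iterate_succ_apply, hstep]
      exact h3 s (by omega)

variable {pc d a b l v : ℕ} {L : List ℕ} {mem : ℕ → ℕ}

theorem setReg {i : Instr} (hi : P[pc]? = some i) (hd : (L[d]?).isSome = true)
    (hexec : i.exec ⟨pc, regs L, mem⟩ = Config.setReg ⟨pc, regs L, mem⟩ d v)
    (haddr : ∀ a, i.address ⟨pc, regs L, mem⟩ = some a → a < S)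
    (hv : Config.Small W ⟨pc, regs L, mem⟩ → v < W)
    (h : Reaches P S W T ⟨pc + 1, regs (L.set d v), mem⟩ Q) :
    Reaches P S W (T + 1) ⟨pc, regs L, mem⟩ Q := by
  refine step (i := i) hi (fun hs => ?_) haddr ?_
  · rw [hexec]
    exact ⟨update_lt hs.1 (hv hs), hs.2⟩
  · rw [hexec, Config.setReg, update_regs (by simpa using hd)]
    exact h

theorem const (hi : P[pc]? = some (.const d v)) (hd : (L[d]?).isSome = true) (hv : v < W)
    (h : Reaches P S W T ⟨pc + 1, regs (L.set d v), mem⟩ Q) :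
    Reaches P S W (T + 1) ⟨pc, regs L, mem⟩ Q :=
  setReg hi hd rfl (by simp [Instr.address]) (fun _ => hv) h

theorem move (hi : P[pc]? = some (.move d a)) (hd : (L[d]?).isSome = true) (v : ℕ) (hv : regs L a = v)
    (h : Reaches P S W T ⟨pc + 1, regs (L.set d v), mem⟩ Q) :
    Reaches P S W (T + 1) ⟨pc, regs L, mem⟩ Q := by
  subst hv
  exact setReg hi hd rfl (by simp [Instr.address]) (fun hs => hs.1 a) h

/-- Only `add` and `const` ask for a word bound: every other instruction writes a value at most one
already held. -/
theorem add (hi : P[pc]? = some (.add d a b)) (hd : (L[d]?).isSome = true) (v : ℕ)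
    (hv : regs L a + regs L b = v) (hW : v < W)
    (h : Reaches P S W T ⟨pc + 1, regs (L.set d v), mem⟩ Q) :
    Reaches P S W (T + 1) ⟨pc, regs L, mem⟩ Q := by
  subst hv
  exact setReg hi hd rfl (by simp [Instr.address]) (fun _ => hW) h

theorem sub (hi : P[pc]? = some (.sub d a b)) (hd : (L[d]?).isSome = true) (v : ℕ)
    (hv : regs L a - regs L b = v)
    (h : Reaches P S W T ⟨pc + 1, regs (L.set d v), mem⟩ Q) :
    Reaches P S W (T + 1) ⟨pc, regs L, mem⟩ Q := by
  subst hv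
  exact setReg hi hd rfl (by simp [Instr.address])
    (fun hs => (Nat.sub_le _ _).trans_lt (hs.1 a)) h

theorem load (hi : P[pc]? = some (.load d a)) (hd : (L[d]?).isSome = true) (v : ℕ) (hS : regs L a < S)
    (hv : mem (regs L a) = v)
    (h : Reaches P S W T ⟨pc + 1, regs (L.set d v), mem⟩ Q) :
    Reaches P S W (T + 1) ⟨pc, regs L, mem⟩ Q := by
  subst hv
  exact setReg hi hd rfl (by simp [Instr.address, hS]) (fun hs => hs.2 _) h

theorem store (hi : P[pc]? = some (.store a b)) (mem' : ℕ → ℕ) (hS : regs L a < S)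
    (hmem : Function.update mem (regs L a) (regs L b) = mem')
    (h : Reaches P S W T ⟨pc + 1, regs L, mem'⟩ Q) :
    Reaches P S W (T + 1) ⟨pc, regs L, mem⟩ Q := by
  subst hmem
  exact step hi (fun hs => ⟨hs.1, update_lt hs.2 (hs.1 b)⟩) (by simp [Instr.address, hS]) h

theorem jump (hi : P[pc]? = some (.jump l)) (h : Reaches P S W T ⟨l, regs L, mem⟩ Q) :
    Reaches P S W (T + 1) ⟨pc, regs L, mem⟩ Q :=
  step hi (fun hs => ⟨hs.1, hs.2⟩) (by simp [Instr.address]) h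

theorem jumpLt (hi : P[pc]? = some (.jumpLt a b l))
    (hlt : regs L a < regs L b → Reaches P S W T ⟨l, regs L, mem⟩ Q)
    (hge : regs L b ≤ regs L a → Reaches P S W T ⟨pc + 1, regs L, mem⟩ Q) :
    Reaches P S W (T + 1) ⟨pc, regs L, mem⟩ Q := by
  refine step hi (fun hs => ⟨hs.1, hs.2⟩) (by simp [Instr.address]) ?_
  simp only [Instr.exec]
  split_ifs with h
  · exact hlt h
  · exact hge (not_lt.1 h)

theorem jumpEq (hi : P[pc]? = some (.jumpEq a b l))
    (heq : regs L a = regs L b → Reaches P S W T ⟨l, regs L, mem⟩ Q)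
    (hne : regs L a ≠ regs L b → Reaches P S W T ⟨pc + 1, regs L, mem⟩ Q) :
    Reaches P S W (T + 1) ⟨pc, regs L, mem⟩ Q := by
  refine step hi (fun hs => ⟨hs.1, hs.2⟩) (by simp [Instr.address]) ?_
  simp only [Instr.exec]
  split_ifs with h
  · exact heq h
  · exact hne h

theorem runsWithin {c : Config} (h : Reaches P S W T c (fun c' => Halted P c' ∧ Q c'))
    (hc : c.Small W) : ∃ c', RunsWithin P T S W c c' ∧ Q c' := by
  obtain ⟨t, ht, ⟨h1, h2⟩, h3, h4⟩ := h hc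
  refine ⟨_, ⟨t, ht, rfl, h1, fun s hs => ?_⟩, h2⟩
  rcases hs.lt_or_eq with hs | rfl
  · exact h4 s hs
  -- A halted configuration has no next instruction, so no address needs a bound.
  · refine ⟨h3.1, h3.2, fun i hi => ?_⟩
    rw [List.getElem?_eq_none h1] at hi
    cases hi

end Reaches

end RAM

/-! ### Memory layout and program -/

namespace CyclicCover

open RAM

/-- The memory of the program: the input, the answers, the table of longest common prefixes, a row
of the table of longest common suffixes, and the table of right ends. -/
def layout (n : ℕ) (x ans Z L A : ℕ → ℕ) (a : ℕ) : ℕ :=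
  if a < n then x a else if a < 2 * n then ans (a - n) else
  if a < 3 * n + 1 then Z (a - 2 * n) else
  if a < 4 * n + 2 then L (a - (3 * n + 1)) else A (a - (4 * n + 2))

section layout

variable {n : ℕ} {x ans Z L A : ℕ → ℕ} {j : ℕ}

theorem layout_letter (h : j < n) : layout n x ans Z L A j = x j := by simp [layout, h]

theorem layout_ans (h : j < n) : layout n x ans Z L A (n + j) = ans j := by
  rw [layout, if_neg (by omega), if_pos (by omega), Nat.add_sub_cancel_left]

theorem layout_lcp (h : j ≤ n) : layout n x ans Z L A (2 * n + j) = Z j := by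
  rw [layout, if_neg (by omega), if_neg (by omega), if_pos (by omega), Nat.add_sub_cancel_left]

theorem layout_lcsuffix (h : j ≤ n) : layout n x ans Z L A (3 * n + 1 + j) = L j := by
  rw [layout, if_neg (by omega), if_neg (by omega), if_neg (by omega), if_pos (by omega),
    Nat.add_sub_cancel_left]

theorem layout_right : layout n x ans Z L A (4 * n + 2 + j) = A j := by
  rw [layout, if_neg (by omega), if_neg (by omega), if_neg (by omega), if_neg (by omega),
    Nat.add_sub_cancel_left]

theorem update_layout_ans (h : j < n) (v : ℕ) :
    Function.update (layout n x ans Z L A) (n + j) v =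
      layout n x (Function.update ans j v) Z L A := by
  funext a
  simp only [layout, Function.update_apply]
  split_ifs <;> first | rfl | omega

theorem update_layout_lcp (h : j ≤ n) (v : ℕ) :
    Function.update (layout n x ans Z L A) (2 * n + j) v =
      layout n x ans (Function.update Z j v) L A := by
  funext a
  simp only [layout, Function.update_apply]
  split_ifs <;> first | rfl | omega

theorem update_layout_lcsuffix (h : j ≤ n) (v : ℕ) :
    Function.update (layout n x ans Z L A) (3 * n + 1 + j) v =
      layout n x ans Z (Function.update L j v) A := by
  funext a
  simp only [layout, Function.update_apply]
  split_ifs <;> first | rfl | omega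

theorem update_layout_right (v : ℕ) :
    Function.update (layout n x ans Z L A) (4 * n + 2 + j) v =
      layout n x ans Z L (Function.update A j v) := by
  funext a
  simp only [layout, Function.update_apply]
  split_ifs <;> first | rfl | omega

end layout

/-- The program. Register `0` holds `n`, `1` the number `1`, `2` the length `k`, `3` the running
position, `7`, `8` and `9` the addresses of the tables, `10` the number `0`, and `12` the last
letter of the prefix of length `k`. -/
def program : Program := [
  .const 1 1, .add 7 0 0, .add 8 7 0, .add 8 8 1, .add 9 8 0, .add 9 9 1,
  -- lines 6 to 20: the table of longest common prefixes
  .move 3 0,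
  .jumpEq 3 10 21,
  .move 4 10,
  .add 5 3 4,
  .jumpEq 5 0 17,
  .load 5 5,
  .load 6 4,
  .jumpEq 5 6 15,
  .jump 17,
  .add 4 4 1,
  .jump 9,
  .add 5 7 3,
  .store 5 4,
  .sub 3 3 1,
  .jump 7,
  -- lines 21 to 24: the next length
  .jumpEq 2 0 66,
  .load 12 2,
  .add 2 2 1,
  .move 3 0,
  -- lines 25 to 49: the next row of longest common suffixes, and the right ends
  .jumpEq 3 10 50,
  .sub 4 3 1,
  .load 5 4,
  .add 6 8 3,
  .jumpEq 5 12 32,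
  .move 5 10,
  .jump 35,
  .sub 5 6 1,
  .load 5 5,
  .add 5 5 1,
  .store 6 5,
  .add 6 7 3,
  .load 6 6,
  .jumpLt 6 2 40,
  .move 6 2,
  .add 4 5 6,
  .jumpLt 4 2 48,
  .sub 4 3 5,
  .add 4 9 4,
  .add 6 3 6,
  .load 11 4,
  .jumpLt 6 11 48,
  .store 4 6,
  .sub 3 3 1,
  .jump 25,
  -- lines 50 to 61: the test for a gap
  .move 4 10,
  .move 5 1,
  .jumpEq 3 0 62,
  .add 6 9 3,
  .load 11 6,
  .store 6 10,
  .jumpLt 11 4 58,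
  .move 4 11,
  .jumpLt 3 4 60,
  .move 5 10,
  .add 3 3 1,
  .jump 52,
  -- lines 62 to 65: the answer
  .add 6 0 2,
  .sub 6 6 1,
  .store 6 5,
  .jump 21]

/-! ### Correctness and cost of the program -/

section program

variable {S W n : ℕ} {x ans Z L A : ℕ → ℕ} {Q : Config → Prop}

/-- The registers of the program: `k`, the running position, and the registers `4`, `5`, `6`, `11`
and `12`. -/
def registers (n k j r s t u v : ℕ) : List ℕ :=
  [n, 1, k, j, r, s, t, 2 * n, 3 * n + 1, 4 * n + 2, 0, u, v]

/-- Induction on the number `m` of letters left after the current match. Here and below, `h` is the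
continuation and `T` its cost. -/
theorem reaches_lcp (hS : 5 * n + 5 ≤ S) (hW : 6 * n + 6 ≤ W) {j : ℕ} (m T : ℕ)
    {z s t : ℕ} (hm : j + z + m = n) (hj : 1 ≤ j) (hz : ∀ t < z, x (j + t) = x t)
    (h : ∀ z s t, IsLcp x n j z → Reaches program S W T
      ⟨17, regs (registers n 0 j z s t 0 0), layout n x ans Z L A⟩ Q) :
    Reaches program S W (T + 8 * m + 6)
      ⟨9, regs (registers n 0 j z s t 0 0), layout n x ans Z L A⟩ Q := by
  induction m generalizing z s t with
  | zero =>
    refine .add rfl rfl (j + z) rfl (by omega) ?_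
    refine .jumpEq rfl (fun _ => ?_) (fun hne => ?_)
    · exact (h z _ _ ⟨by omega, hz, .inl (by omega)⟩).mono (by omega)
    · exact absurd (show j + z = n by omega) hne
  | succ m ih =>
    refine .mono (T := T + 8 * m + 6 + 7 + 1) ?_ (by omega)
    refine .add rfl rfl (j + z) rfl (by omega) ?_
    refine .jumpEq rfl (fun heq => ?_) (fun _ => ?_)
    · have : j + z = n := heq
      omega
    refine .load rfl rfl (x (j + z)) (show j + z < S by omega)
      (layout_letter (show j + z < n by omega)) ?_
    refine .load rfl rfl (x z) (show z < S by omega)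
      (layout_letter (show z < n by omega)) ?_
    refine .jumpEq rfl (fun heq => ?_) (fun hne => ?_)
    · refine .add rfl rfl (z + 1) rfl (by omega) ?_
      refine .jump rfl ?_
      refine (ih (by omega) fun t ht => ?_).mono (by omega)
      rcases Nat.lt_succ_iff_lt_or_eq.1 ht with ht | rfl
      · exact hz t ht
      · exact heq
    · refine .jump rfl ?_
      exact (h z _ _ ⟨by omega, hz, .inr hne⟩).mono (by omega)

theorem reaches_lcp_table (hS : 5 * n + 5 ≤ S) (hW : 6 * n + 6 ≤ W) (j T : ℕ) {r s t : ℕ}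
    (hj : j ≤ n) (hZ : ∀ i, j < i → i ≤ n → IsLcp x n i (Z i))
    (h : ∀ Z r s t, (∀ i, 1 ≤ i → i ≤ n → IsLcp x n i (Z i)) → Reaches program S W T
      ⟨21, regs (registers n 0 0 r s t 0 0), layout n x ans Z L A⟩ Q) :
    Reaches program S W (T + j * (8 * n + 12) + 1)
      ⟨7, regs (registers n 0 j r s t 0 0), layout n x ans Z L A⟩ Q := by
  induction j generalizing Z r s t with
  | zero =>
    refine .jumpEq rfl (fun _ => ?_) (fun hne => absurd rfl hne)
    exact (h Z r s t fun i hi => hZ i hi).mono (by omega)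
  | succ j ih =>
    have hB : (j + 1) * (8 * n + 12) = j * (8 * n + 12) + (8 * n + 12) := Nat.succ_mul _ _
    refine .mono (T := T + j * (8 * n + 12) + 1 + 4 + 8 * (n - (j + 1)) + 6 + 2) ?_ (by omega)
    refine .jumpEq rfl (fun heq => absurd heq (Nat.succ_ne_zero j)) (fun _ => ?_)
    refine .move rfl rfl 0 rfl ?_
    refine reaches_lcp hS hW (n - (j + 1)) _ (by omega) (by omega) (by simp) fun z s t hz => ?_
    refine .add rfl rfl (2 * n + (j + 1)) rfl (by omega) ?_
    refine .store rfl _ (show 2 * n + (j + 1) < S by omega) (update_layout_lcp hj z) ?_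
    refine .sub rfl rfl j rfl ?_
    refine .jump rfl (ih (by omega) fun i hi hin => ?_)
    rcases (Nat.succ_le_of_lt hi).eq_or_lt with rfl | hi
    · simpa using hz
    · rw [Function.update_of_ne (by omega)]
      exact hZ i hi hin

/-- `A a` is the largest right end of an interval of covered positions with the left end `a`,
among those split after `j`, up to intervals with this left end. -/
def IsRight (x Z : ℕ → ℕ) (n k j : ℕ) (A : ℕ → ℕ) : Prop :=
  (∀ a, A a = 0 ∨ ∃ i, j < i ∧ IsSplit x Z n k i ∧ a = i - lcsuffix x k i ∧
    A a = i + min (Z i) k) ∧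
  ∀ i, j < i → IsSplit x Z n k i → i + min (Z i) k ≤ A (i - lcsuffix x k i)

theorem IsRight.of_not_isSplit {k j : ℕ} (h : IsRight x Z n k (j + 1) A)
    (hj : ¬ IsSplit x Z n k (j + 1)) : IsRight x Z n k j A := by
  refine ⟨fun a => (h.1 a).imp_right ?_, fun i hi hs => ?_⟩
  · rintro ⟨i, hi, h'⟩
    exact ⟨i, by omega, h'⟩
  · rcases (Nat.succ_le_of_lt hi).eq_or_lt with rfl | hi
    · exact absurd hs hj
    · exact h.2 i hi hs

theorem IsRight.of_le {k j : ℕ} (h : IsRight x Z n k (j + 1) A)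
    (hj : j + 1 + min (Z (j + 1)) k ≤ A (j + 1 - lcsuffix x k (j + 1))) :
    IsRight x Z n k j A := by
  refine ⟨fun a => (h.1 a).imp_right ?_, fun i hi hs => ?_⟩
  · rintro ⟨i, hi, h'⟩
    exact ⟨i, by omega, h'⟩
  · rcases (Nat.succ_le_of_lt hi).eq_or_lt with rfl | hi
    · exact hj
    · exact h.2 i hi hs

theorem IsRight.update {k j : ℕ} (h : IsRight x Z n k (j + 1) A)
    (hs : IsSplit x Z n k (j + 1))
    (hj : A (j + 1 - lcsuffix x k (j + 1)) ≤ j + 1 + min (Z (j + 1)) k) :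
    IsRight x Z n k j
      (Function.update A (j + 1 - lcsuffix x k (j + 1)) (j + 1 + min (Z (j + 1)) k)) := by
  refine ⟨fun a => ?_, fun i hi hs => ?_⟩
  · by_cases ha : a = j + 1 - lcsuffix x k (j + 1)
    · exact .inr ⟨j + 1, by omega, hs, ha, by rw [ha, Function.update_self]⟩
    · rw [Function.update_of_ne ha]
      refine (h.1 a).imp_right ?_
      rintro ⟨i, hi, h'⟩
      exact ⟨i, by omega, h'⟩
  · rcases (Nat.succ_le_of_lt hi).eq_or_lt with rfl | hi
    · rw [Function.update_self]
    · have := h.2 i hi hs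
      by_cases ha : i - lcsuffix x k i = j + 1 - lcsuffix x k (j + 1)
      · rw [ha] at this ⊢
        rw [Function.update_self]
        exact this.trans hj
      · rwa [Function.update_of_ne ha]

/-- The row is overwritten in place. Since `j` descends, the entry to the left still belongs to the
old row when the recurrence reads it. -/
theorem reaches_row (hS : 5 * n + 5 ≤ S) (hW : 6 * n + 6 ≤ W) {k : ℕ} (j T : ℕ) {r s t u : ℕ}
    (hk : k < n) (hj : j ≤ n) (hZ : ∀ i, 1 ≤ i → i ≤ n → IsLcp x n i (Z i))
    (hle : ∀ i ≤ j, L i = lcsuffix x k i)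
    (hgt : ∀ i, j < i → i ≤ n → L i = lcsuffix x (k + 1) i)
    (hA : IsRight x Z n (k + 1) j A)
    (h : ∀ L A r s t u, (∀ i ≤ n, L i = lcsuffix x (k + 1) i) → IsRight x Z n (k + 1) 0 A →
      Reaches program S W T
        ⟨50, regs (registers n (k + 1) 0 r s t u (x k)), layout n x ans Z L A⟩ Q) :
    Reaches program S W (T + 25 * j + 1)
      ⟨25, regs (registers n (k + 1) j r s t u (x k)), layout n x ans Z L A⟩ Q := by
  induction j generalizing L A r s t u with
  | zero =>
    refine .jumpEq rfl (fun _ => ?_) (fun hne => absurd rfl hne)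
    refine (h L A _ _ _ _ (fun i hi => ?_) hA).mono (by omega)
    -- Cell `0` is never rewritten, but both rows are `0` there.
    cases i with
    | zero =>
      have h1 := lcsuffix_le_right x k 0
      have h2 := lcsuffix_le_right x (k + 1) 0
      rw [hle 0 le_rfl]
      omega
    | succ i => exact hgt _ (by omega) hi
  | succ j ih =>
    have hlk := lcsuffix_le_left x (k + 1) (j + 1)
    have hlj := lcsuffix_le_right x (k + 1) (j + 1)
    have hzn := (hZ (j + 1) (by omega) hj).1
    set l := lcsuffix x (k + 1) (j + 1) with hl
    set L' := Function.update L (j + 1) l with hL'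
    -- `next`, `mark` and `put` treat the places where branches of the loop body merge, last one
    -- first, so that each common tail is verified once.
    have next (A r s t u) (hA : IsRight x Z n (k + 1) j A) :
        Reaches program S W (T + 25 * j + 3)
          ⟨48, regs (registers n (k + 1) (j + 1) r s t u (x k)), layout n x ans Z L' A⟩ Q := by
      refine .sub rfl rfl j rfl (.jump rfl (ih (by omega) (fun i hi => ?_) (fun i hi hin => ?_) hA))
      · rw [hL', Function.update_of_ne (by omega)]
        exact hle i (by omega)
      · rcases (Nat.succ_le_of_lt hi).eq_or_lt with rfl | hi
        · rw [hL', Function.update_self]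
        · rw [hL', Function.update_of_ne (by omega)]
          exact hgt i hi hin
    have mark (r u) : Reaches program S W (T + 25 * j + 11)
        ⟨40, regs (registers n (k + 1) (j + 1) r l (min (Z (j + 1)) (k + 1)) u (x k)),
          layout n x ans Z L' A⟩ Q := by
      refine .add rfl rfl (l + min (Z (j + 1)) (k + 1)) rfl (by omega) ?_
      refine .jumpLt rfl (fun hlt => ?_) (fun hge => ?_)
      · exact (next A _ _ _ _ (hA.of_not_isSplit fun hs => absurd hs.2.2
          (not_le.2 hlt))).mono (by omega)
      have hs : IsSplit x Z n (k + 1) (j + 1) := ⟨by omega, hj, hge⟩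
      refine .sub rfl rfl (j + 1 - l) rfl ?_
      refine .add rfl rfl (4 * n + 2 + (j + 1 - l)) rfl (by omega) ?_
      refine .add rfl rfl (j + 1 + min (Z (j + 1)) (k + 1)) rfl (by omega) ?_
      refine .load rfl rfl (A (j + 1 - l)) (show 4 * n + 2 + (j + 1 - l) < S by omega)
        layout_right ?_
      refine .jumpLt rfl (fun hlt => ?_) (fun hge => ?_)
      · exact (next A _ _ _ _ (hA.of_le (le_of_lt hlt))).mono (by omega)
      · refine .store rfl _ (show 4 * n + 2 + (j + 1 - l) < S by omega)
          (update_layout_right (j + 1 + min (Z (j + 1)) (k + 1))) ?_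
        exact (next _ _ _ _ _ (hA.update hs hge)).mono (by omega)
    have put (r u) : Reaches program S W (T + 25 * j + 16)
        ⟨35, regs (registers n (k + 1) (j + 1) r l (3 * n + 1 + (j + 1)) u (x k)),
          layout n x ans Z L A⟩ Q := by
      refine .store rfl _ (show 3 * n + 1 + (j + 1) < S by omega) (update_layout_lcsuffix hj l) ?_
      refine .add rfl rfl (2 * n + (j + 1)) rfl (by omega) ?_
      refine .load rfl rfl (Z (j + 1)) (show 2 * n + (j + 1) < S by omega) (layout_lcp hj) ?_
      refine .jumpLt rfl (fun hlt => ?_) (fun hge => ?_)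
      · have := mark r u
        rw [min_eq_left (show Z (j + 1) ≤ k + 1 from le_of_lt hlt)] at this
        exact this.mono (by omega)
      · have := mark r u
        rw [min_eq_right (show k + 1 ≤ Z (j + 1) from hge)] at this
        exact .move rfl rfl (k + 1) rfl (this.mono (by omega))
    refine .mono (T := T + 25 * j + 16 + 3 + 1 + 1 + 1 + 1 + 1) ?_ (by omega)
    refine .jumpEq rfl (fun heq => absurd heq (Nat.succ_ne_zero j)) (fun _ => ?_)
    refine .sub rfl rfl j rfl ?_
    refine .load rfl rfl (x j) (show j < S by omega)
      (layout_letter (show j < n by omega)) ?_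
    refine .add rfl rfl (3 * n + 1 + (j + 1)) rfl (by omega) ?_
    refine .jumpEq rfl (fun heq => ?_) (fun hne => ?_)
    -- The recurrence for `lcsuffix` holds by definitional unfolding.
    · have hl1 : lcsuffix x k j + 1 = l := (if_pos heq).symm
      refine .sub rfl rfl (3 * n + 1 + j) rfl ?_
      refine .load rfl rfl (lcsuffix x k j) (show 3 * n + 1 + j < S by omega)
        ((layout_lcsuffix (by omega)).trans (hle j (by omega))) ?_
      exact .add rfl rfl l hl1 (by omega) (put _ _)
    · have hl0 : 0 = l := (if_neg hne).symm
      refine .move rfl rfl l hl0 (.jump rfl ?_)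
      exact (put _ _).mono (by omega)

/-- `f` is `1` if `p` holds and `0` otherwise. -/
def IsFlag (p : Prop) (f : ℕ) : Prop := (p → f = 1) ∧ (¬ p → f = 0)

/-- `B` is the table before the sweep and `A` its current state, cleared below `a` to be ready for
the next length. The running maximum `r` is described by the numbers below it. -/
theorem reaches_scan (hS : 5 * n + 5 ≤ S) (hW : 6 * n + 6 ≤ W) {k v : ℕ} {B : ℕ → ℕ} (m T : ℕ)
    {a r s t u : ℕ} (hm : a + m = n) (hlt : ∀ i < a, A i = 0) (hge : ∀ i, a ≤ i → A i = B i)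
    (hr : ∀ i, i < r ↔ ∃ b < a, i < B b)
    (hs : IsFlag (∀ i < a, ∃ b ≤ i, i < B b) s)
    (h : ∀ A r s t u, (∀ i < n, A i = 0) → (∀ i, n ≤ i → A i = B i) →
      IsFlag (∀ i < n, ∃ b ≤ i, i < B b) s → Reaches program S W T
        ⟨62, regs (registers n k n r s t u v), layout n x ans Z L A⟩ Q) :
    Reaches program S W (T + 10 * m + 1)
      ⟨52, regs (registers n k a r s t u v), layout n x ans Z L A⟩ Q := by
  induction m generalizing A a r s t u with
  | zero =>
    obtain rfl : a = n := hm
    refine .jumpEq rfl (fun _ => ?_) (fun hne => absurd rfl hne)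
    exact (h A _ _ _ _ hlt hge hs).mono (by omega)
  | succ m ih =>
    have hA' (i : ℕ) (hi : i < a + 1) : Function.update A a 0 i = 0 := by
      by_cases hia : i = a
      · rw [hia, Function.update_self]
      · rw [Function.update_of_ne hia]; exact hlt i (by omega)
    have hB' (i : ℕ) (hi : a + 1 ≤ i) : Function.update A a 0 i = B i := by
      rw [Function.update_of_ne (by omega)]; exact hge i (by omega)
    have flag (r t u) (hr : ∀ i, i < r ↔ ∃ b < a + 1, i < B b) :
        Reaches program S W (T + 10 * m + 5)
          ⟨58, regs (registers n k a r s t u v),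
            layout n x ans Z L (Function.update A a 0)⟩ Q := by
      -- Position `a` is covered iff the maximum, now including `B a`, exceeds it.
      have hp : (∀ i < a + 1, ∃ b ≤ i, i < B b) ↔ (∀ i < a, ∃ b ≤ i, i < B b) ∧ a < r := by
        simp only [hr, Nat.lt_succ_iff]
        constructor
        · exact fun hp => ⟨fun i hi => hp i (by omega), hp a le_rfl⟩
        · rintro ⟨h1, h2⟩ i hi
          rcases hi.lt_or_eq with hi | rfl
          · exact h1 i hi
          · exact h2
      refine .jumpLt rfl (fun hlt => ?_) (fun hge => ?_)
      · have hlt' : a < r := hlt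
        refine .add rfl rfl (a + 1) rfl (by omega) (.jump rfl ?_)
        refine (ih (by omega) hA' hB' hr ?_).mono (by omega)
        rwa [hp, and_iff_left hlt']
      · have hge' : r ≤ a := hge
        refine .move rfl rfl 0 rfl ?_
        refine .add rfl rfl (a + 1) rfl (by omega) (.jump rfl ?_)
        refine ih (by omega) hA' hB' hr ⟨fun h => ?_, fun _ => rfl⟩
        exact absurd (hp.1 h).2 (not_lt.2 hge')
    refine .mono (T := T + 10 * m + 5 + 1 + 1 + 1 + 1 + 1 + 1) ?_ (by omega)
    refine .jumpEq rfl (fun heq => ?_) (fun _ => ?_)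
    · have : a = n := heq
      omega
    refine .add rfl rfl (4 * n + 2 + a) rfl (by omega) ?_
    refine .load rfl rfl (B a) (show 4 * n + 2 + a < S by omega)
      (layout_right.trans (hge a le_rfl)) ?_
    refine .store rfl _ (show 4 * n + 2 + a < S by omega) (update_layout_right 0) ?_
    refine .jumpLt rfl (fun hlt => ?_) (fun hge => ?_)
    · have hlt' : B a < r := hlt
      refine (flag r _ _ fun i => ?_).mono (by omega)
      rw [hr]
      constructor
      · rintro ⟨b, hb, hi⟩
        exact ⟨b, by omega, hi⟩
      · rintro ⟨b, hb, hi⟩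
        rcases (Nat.lt_succ_iff.1 hb).lt_or_eq with hb | rfl
        · exact ⟨b, hb, hi⟩
        · exact (hr i).1 (hi.trans hlt')
    · have hge' : r ≤ B a := hge
      refine .move rfl rfl (B a) rfl (flag _ _ _ fun i => ⟨fun hi => ⟨a, by omega, hi⟩, ?_⟩)
      rintro ⟨b, hb, hi⟩
      rcases (Nat.lt_succ_iff.1 hb).lt_or_eq with hb | rfl
      · exact ((hr i).2 ⟨b, hb, hi⟩).trans_le hge'
      · exact hi

/-- Among intervals with the same left end, the longest contains the others. -/
theorem IsRight.covered_iff {k i : ℕ} (h : IsRight x Z n k 0 A) :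
    Covered x Z n k i ↔ ∃ b ≤ i, i < A b := by
  constructor
  · rintro ⟨j, hs, h1, h2⟩
    exact ⟨_, h1, h2.trans_le (h.2 j hs.1 hs)⟩
  · rintro ⟨b, hb, hi⟩
    rcases h.1 b with h0 | ⟨j, -, hs, rfl, hA⟩
    · omega
    · exact ⟨j, hs, hb, by omega⟩

/-- A nonempty interval inside the word starts before `n`; hence clearing the first `n` cells clears
the whole table. -/
theorem IsRight.eq_zero {k a : ℕ} (h : IsRight x Z n k 0 A) (hk : 1 ≤ k)
    (hZ : ∀ i, 1 ≤ i → i ≤ n → IsLcp x n i (Z i)) (ha : n ≤ a) : A a = 0 := by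
  rcases h.1 a with h0 | ⟨j, -, ⟨h1, h2, h3⟩, rfl, -⟩
  · exact h0
  · have := (hZ j h1 h2).1
    omega

/-- Induction on the number `m` of lengths still to be tested. A length costs `25 n` for the row,
`10 n` for the sweep and `12` for the rest. -/
theorem reaches_halted (hS : 5 * n + 5 ≤ S) (hW : 6 * n + 6 ≤ W) (m : ℕ)
    {k j r s t u v : ℕ} (hm : k + m = n)
    (hZ : ∀ i, 1 ≤ i → i ≤ n → IsLcp x n i (Z i)) (hL : ∀ i ≤ n, L i = lcsuffix x k i)
    (hA : ∀ a, A a = 0) (hans : ∀ i < k, IsFlag (∀ p < n, Covered x Z n (i + 1) p) (ans i)) :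
    Reaches program S W (m * (35 * n + 12) + 1)
      ⟨21, regs (registers n k j r s t u v), layout n x ans Z L A⟩
      (fun c => Halted program c ∧
        ∀ i < n, IsFlag (∀ p < n, Covered x Z n (i + 1) p) (c.mem (n + i))) := by
  induction m generalizing k j r s t u v L A ans with
  | zero =>
    obtain rfl : k = n := hm
    refine .jumpEq rfl (fun _ => .of_post ⟨le_rfl, fun i hi => ?_⟩) (fun hne => absurd rfl hne)
    simpa only [layout_ans hi] using hans i hi
  | succ m ih =>
    have hB : (m + 1) * (35 * n + 12) = m * (35 * n + 12) + (35 * n + 12) := Nat.succ_mul _ _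
    refine .mono (T := m * (35 * n + 12) + 1 + 4 + 10 * n + 1 + 2 + 25 * n + 1 + 4) ?_ (by omega)
    refine .jumpEq rfl (fun heq => ?_) (fun _ => ?_)
    · have : k = n := heq
      omega
    refine .load rfl rfl (x k) (show k < S by omega)
      (layout_letter (show k < n by omega)) ?_
    refine .add rfl rfl (k + 1) rfl (by omega) ?_
    refine .move rfl rfl n rfl ?_
    refine reaches_row hS hW n _ (by omega) le_rfl hZ hL (fun i hi hin => by omega)
      ⟨fun a => .inl (hA a), fun i hi hs => absurd hs.2.1 (by omega)⟩
      fun L A r s t u hL hA => ?_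
    refine .move rfl rfl 0 rfl ?_
    refine .move rfl rfl 1 rfl ?_
    refine reaches_scan (B := A) hS hW n _ (by omega) (by simp) (fun _ _ => rfl) (by simp)
      ⟨fun _ => rfl, fun h => absurd (by simp) h⟩ fun A' r s t u h0 h1 hs => ?_
    refine .add rfl rfl (n + (k + 1)) rfl (by omega) ?_
    refine .sub rfl rfl (n + k) rfl ?_
    refine .store rfl _ (show n + k < S by omega) (update_layout_ans (by omega) s) ?_
    refine .jump rfl (ih (by omega) hL (fun a => ?_) fun i hi => ?_)
    · rcases lt_or_ge a n with ha | ha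
      · exact h0 a ha
      · rw [h1 a ha]
        exact hA.eq_zero (by omega) hZ ha
    · rcases (Nat.lt_succ_iff.1 hi).lt_or_eq with hi | rfl
      · rw [Function.update_of_ne (by omega)]
        exact hans i hi
      · rw [Function.update_self]
        simpa only [hA.covered_iff] using hs

end program

/-! ### Initial configuration and conclusion -/

theorem init_eq {σ : ℕ} (x : List (Fin σ)) :
    RAM.init x = ⟨0, regs [x.length, 0, 0, 0, 0, 0, 0, 0, 0, 0, 0, 0, 0],
      layout x.length (letter x) (fun _ => 0) (fun _ => 0) (fun _ => 0) (fun _ => 0)⟩ := by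
  simp only [RAM.init, Config.mk.injEq, true_and]
  constructor
  · funext r
    by_cases h : r < 13
    · interval_cases r <;> rfl
    · rw [regs, List.getD_eq_default _ _ (by simpa using h), if_neg (by omega)]
  · funext a
    simp only [layout, ite_self]
    split_ifs with h
    · rfl
    · rw [List.getElem?_eq_none (by omega)]; rfl

theorem init_small {σ W : ℕ} (x : List (Fin σ)) (hW : x.length + σ < W) :
    (RAM.init x).Small W := by
  constructor
  · intro r
    simp only [RAM.init]
    split_ifs <;> omega
  · intro a
    simp only [RAM.init]
    cases x[a]? with
    | none => simp; omega
    | some y => simp; omega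

end CyclicCover

/-- One program, with one constant `C`, tests every string `x` over every alphabet
`{0, …, σ - 1}` for `k`-cyclic coverability for all `1 ≤ k ≤ n`, where `n` is the length of `x`:
it halts after `O(n ^ 2)` steps, uses `O(n)` memory cells (input and output included), each of
which holds a number of size `O(n + σ)`, that is, a word of `O(log (n + σ))` bits, and leaves the
answer for `k`, as `1` or `0`, in the `k`-th memory cell after the input. -/
theorem theorem5 :
    ∃ (P : RAM.Program) (C : ℕ), ∀ (σ : ℕ) (x : List (Fin σ)), ∃ c : RAM.Config,
      RAM.RunsWithin P (C * (x.length ^ 2 + 1)) (C * (x.length + 1)) (C * (x.length + σ + 1))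
        (RAM.init x) c ∧
      ∀ k, 1 ≤ k → k ≤ x.length →
        (CyclicCover.Coverable x k → c.mem (x.length + (k - 1)) = 1) ∧
        (¬ CyclicCover.Coverable x k → c.mem (x.length + (k - 1)) = 0) := by
  refine ⟨CyclicCover.program, 100, fun σ x => ?_⟩
  have hsmall := CyclicCover.init_small (W := 100 * (x.length + σ + 1)) x (by omega)
  have hS : 5 * x.length + 5 ≤ 100 * (x.length + 1) := by omega
  have hW : 6 * x.length + 6 ≤ 100 * (x.length + σ + 1) := by omega
  suffices h : RAM.Reaches CyclicCover.program (100 * (x.length + 1)) (100 * (x.length + σ + 1))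
      (100 * (x.length ^ 2 + 1)) (RAM.init x) (fun c => RAM.Halted CyclicCover.program c ∧
        ∀ k, 1 ≤ k → k ≤ x.length →
          (CyclicCover.Coverable x k → c.mem (x.length + (k - 1)) = 1) ∧
          (¬ CyclicCover.Coverable x k → c.mem (x.length + (k - 1)) = 0)) from
    h.runsWithin hsmall
  rw [CyclicCover.init_eq]
  generalize hn : x.length = n at *
  -- The main loop, the table `Z` and seven initial instructions: `43 n ^ 2 + 24 n + 9` in all.
  refine .mono (T := n * (35 * n + 12) + 1 + n * (8 * n + 12) + 1 + 7) ?_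
    (by nlinarith [Nat.le_self_pow two_ne_zero n])
  refine .const rfl rfl (by omega) ?_
  refine .add rfl rfl (2 * n) (two_mul n).symm (by omega) ?_
  refine .add rfl rfl (3 * n) (show 2 * n + n = 3 * n by omega) (by omega) ?_
  refine .add rfl rfl (3 * n + 1) rfl (by omega) ?_
  refine .add rfl rfl (4 * n + 1) (show 3 * n + 1 + n = 4 * n + 1 by omega) (by omega) ?_
  refine .add rfl rfl (4 * n + 2) rfl (by omega) ?_
  refine .move rfl rfl n rfl ?_
  refine CyclicCover.reaches_lcp_table hS hW n _ le_rfl (fun i hi hin => by omega)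
    fun Z r s t hZ => ?_
  obtain rfl := hn
  -- The zeroed memory already holds the row of `lcsuffix` for length `0` and an empty table of
  -- right ends.
  have hrun := CyclicCover.reaches_halted (ans := fun _ => 0) (L := fun _ => 0) (A := fun _ => 0)
    (r := r) (s := s) (t := t) (u := 0) (v := 0) (j := 0) hS hW x.length (zero_add _) hZ
    (fun i _ => rfl) (fun _ => rfl) (fun i hi => absurd hi (Nat.not_lt_zero i))
  refine hrun.imp fun c => And.imp_right fun h k hk hkn => ?_
  have := h (k - 1) (by omega)
  rw [Nat.sub_add_cancel hk, ← CyclicCover.coverable_iff_forall_covered hk hkn hZ] at this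
  exact this
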